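/- Let $B$ be a finite non-empty set and let $M=(m_{\alpha\beta})_{\alpha,\beta\in B}$ be a Coxeter matrix, i.e. $m_{\alpha\alpha}=1$ and $m_{\alpha\beta}=m_{\beta\alpha}\in\mathbb Z_{\ge 2}\cup\{\infty\}$ for $\alpha\ne\beta$. Let $\Gamma_M$ be the associated Artin monoid, i.e. the quotient of the free monoid on $B$ by the relations $\langle\alpha\beta\rangle^{m_{\alpha\beta}}=\langle\beta\alpha\rangle^{m_{\alpha\beta}}$ for all $\alpha,\beta\in B$ with $m_{\alpha\beta}<\infty$, where $\langle\alpha\beta\rangle^{m}=\alpha\beta\alpha\cdots$ is the alternating word of length $m$ starting with $\alpha$. Let $G\subset\Gamma_M$ be the set of images of the letters in $B$ (the standard generator system). Assume that $\Gamma_M$ is of finite type, i.e. that the Coxeter group $\langle B\mid (\alpha\beta)^{m_{\alpha\beta}}=1 \text{ for all } \alpha,\beta\in B \text{ with } m_{\alpha\beta}<\infty\rangle$ is finite. Then $(\Gamma_M,G)$ belongs to the class $\mathcal C$. That is, $G$ is a finite set generating $\Gamma:=\Gamma_M$ as a monoid, and: 1. $\Gamma$ is infinite; 2. $\Gamma$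 is cancellative: $aub=avb$ implies $u=v$ for all $a,b,u,v\in\Gamma$; 3. $\Gamma$ is homogeneous with respect to $G$: the length $l(g):=\min\{n\ge 0\mid g=g_1\cdots g_n \text{ for some } g_1,\dots,g_n\in G\}$ satisfies $l(gh)=l(g)+l(h)$ for all $g,h\in\Gamma$; 4. (GCD$_l$) for all $u,v\in\Gamma$ there is a unique $d\in\Gamma$ such that $d$ is a left divisor of both $u$ and $v$, and every common left divisor of $u$ and $v$ is a left divisor of $d$ (here $x$ is a left divisor of $y$ if $y=xz$ for some $z\in\Gamma$); 5. (CM$_r$) for all $u,v\in\Gamma$ there are $a,b\in\Gamma$ with $au=bv$. -/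

import Mathlib

/-- The length of `g` with respect to `G`: the least `n` such that `g` is a product of `n` elements
of `G`. It is meaningful when `G` generates `Γ` (otherwise it is `0` off the submonoid generated
by `G`). -/
noncomputable def genLength {Γ : Type*} [Monoid Γ] (G : Set Γ) (g : Γ) : ℕ :=
  sInf {n : ℕ | ∃ w : List Γ, (∀ x ∈ w, x ∈ G) ∧ w.length = n ∧ w.prod = g}

/-- `Γ` is homogeneous with respect to `G`: the length function is additive. -/
def IsHomogeneousMonoid {Γ : Type*} [Monoid Γ] (G : Set Γ) : Prop :=
  ∀ g h : Γ, genLength G (g * h) = genLength G g + genLength G h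

/-- `u` is a left divisor of `w`. -/
def LeftDivides {Γ : Type*} [Monoid Γ] (u w : Γ) : Prop := ∃ a : Γ, w = u * a

/-- `u` is a right divisor of `w`. -/
def RightDivides {Γ : Type*} [Monoid Γ] (u w : Γ) : Prop := ∃ a : Γ, w = a * u

/-- Condition `GCD_l`: any two elements have a unique greatest common left divisor. -/
def HasLeftGCD (Γ : Type*) [Monoid Γ] : Prop :=
  ∀ u v : Γ, ∃! d : Γ, LeftDivides d u ∧ LeftDivides d v ∧
    ∀ w : Γ, LeftDivides w u → LeftDivides w v → LeftDivides w d

/-- Condition `CM_r`: any two elements `u`, `v` are right divisors of a common element, that is,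
`a * u = b * v` for some `a`, `b`. -/
def HasCommonRightMultiples (Γ : Type*) [Monoid Γ] : Prop :=
  ∀ u v : Γ, ∃ w : Γ, RightDivides u w ∧ RightDivides v w

/-- The pair `(Γ, G)` is of class `𝒞`. -/
structure IsOfClassC (Γ : Type*) [Monoid Γ] (G : Set Γ) : Prop where
  finite_generators : G.Finite
  generates : Submonoid.closure G = ⊤
  infinite : Infinite Γ
  cancellative : ∀ a b u v : Γ, a * u * b = a * v * b → u = v
  homogeneous : IsHomogeneousMonoid G
  leftGCD : HasLeftGCD Γ
  commonRightMultiples : HasCommonRightMultiples Γ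

/-- The alternating word `a b a ⋯` of length `m`, starting with the letter `a`. -/
def altWord {B : Type*} (a b : B) : ℕ → FreeMonoid B
  | 0 => 1
  | m + 1 => FreeMonoid.of a * altWord b a m

/-- The defining relations of the Artin monoid of the Coxeter matrix `M`. In Mathlib the entry `0`
of a Coxeter matrix stands for `∞`; the corresponding relation is the trivial one `1 = 1`. -/
inductive ArtinRel {B : Type*} (M : CoxeterMatrix B) : FreeMonoid B → FreeMonoid B → Prop
  | braid (a b : B) : ArtinRel M (altWord a b (M a b)) (altWord b a (M a b))

/-- The Artin monoid of the Coxeter matrix `M`. -/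
abbrev ArtinMonoid {B : Type*} (M : CoxeterMatrix B) : Type _ := PresentedMonoid (ArtinRel M)

/-- The standard generator system of the Artin monoid of `M`. -/
def ArtinMonoid.standardGenerators {B : Type*} (M : CoxeterMatrix B) : Set (ArtinMonoid M) :=
  Set.range (PresentedMonoid.of (ArtinRel M))

/-- `M` (or its Artin monoid) is of finite type: the associated Coxeter group is finite. -/
def CoxeterMatrix.IsFiniteType {B : Type*} (M : CoxeterMatrix B) : Prop := Finite M.Group

/-! Divisibility in the Artin monoid Γ is controlled by the weak (prefix) order of the Coxeter group
W. By Matsumoto's theorem (`ofWord_eq_of_isReduced`) every w in W has a well-defined lift `artinLift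
w`, multiplicative on products in which lengths add. For a generator a and w in W there is a
greatest prefix v of w with s_a v reduced (`exists_isGreatestPrefix`). Sending (w, y) to (s_a v,
lift(v⁻¹w) y) makes a act on W × Γ. Along a reduced word these steps compose to a single step that
depends only on the product (`lift_normalFormStep_apply`), so the braid relations hold and Γ acts.

The orbit of (1, 1) factors each x into a simple head and a tail. Those of ax determine x, hence
left cancellation; word reversal gives right cancellation. If a and b both divide x on the left,
both are descents of its head, so the head, and with it x, starts with the braid word on a and b.
This local fact gives gcds by the diamond argument `Relation.ReflTransGen.exists_greatest`, which
also produces the greatest prefixes in W.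

The input about W is that s_a s_b has order exactly `M a b` (geometric representation) and that
lengths add along parabolic cosets. Finiteness of W serves only CM_r: every lift right-divides the
lift of the inverse of the longest element. Homogeneity and infinitude hold because the relations
preserve length. -/

/-! ### Order of a product of two reflections, via Chebyshev polynomials -/

section ReflectionOrder

open Polynomial Polynomial.Chebyshev Module

/-- If the angle between two reflections over `ℝ` is `π / m` with `2 ≤ m`, the `m`-th power of
their product is trivial. -/
theorem Module.reflection_mul_reflection_pow_eq_one {V : Type*} [AddCommGroup V] [Module ℝ V]
    {x y : V} {f g : Dual ℝ V} (hf : f x = 2) (hg : g y = 2) {m : ℕ} (hm : 2 ≤ m)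
    (hfy : f y = -2 * Real.cos (Real.pi / m)) (hgx : g x = -2 * Real.cos (Real.pi / m)) :
    (reflection hf * reflection hg) ^ m = 1 := by
  have hm0 : (m : ℝ) ≠ 0 := by positivity
  rcases hm.eq_or_lt with rfl | hm
  -- For m = 2 the angle θ is π and sin θ = 0, so the division by sin θ used below is unavailable.
  · have h1 : f y = 0 := by rw [hfy]; simp
    have h2 : g x = 0 := by rw [hgx]; simp
    ext z
    simp only [pow_two, LinearEquiv.mul_apply, reflection_apply, map_sub, map_smul, hf, hg, h1, h2,
      LinearEquiv.coe_one, id_eq]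
    module
  set θ : ℝ := 2 * (Real.pi / m) with hθ
  have ht : f y * g x - 2 = 2 * Real.cos θ := by
    rw [hfy, hgx, hθ, Real.cos_two_mul]; ring
  have hsin : Real.sin θ ≠ 0 := by
    apply ne_of_gt
    apply Real.sin_pos_of_pos_of_lt_pi
    · have := Real.pi_pos
      positivity
    · have h3 : (3 : ℝ) ≤ m := by exact_mod_cast hm
      have : Real.pi / m ≤ Real.pi / 3 := by
        apply div_le_div_of_nonneg_left Real.pi_pos.le (by norm_num) h3
      have := Real.pi_pos
      linarith
  have hS (k : ℤ) : (S ℝ k).eval (2 * Real.cos θ) * Real.sin θ = Real.sin ((k + 1) * θ) :=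
    S_two_mul_real_cos θ k
  -- For m = 2k + 1 the angles (k + 1)θ and kθ are π ± π/m, whose sines cancel.
  have hsum (k : ℤ) (hk : (2 * k + 1 : ℝ) = m) :
      (S ℝ k).eval (2 * Real.cos θ) + (S ℝ (k - 1)).eval (2 * Real.cos θ) = 0 := by
    apply mul_right_cancel₀ hsin
    rw [add_mul, hS, hS, zero_mul]
    push_cast
    have e1 : (k + 1 : ℝ) * θ = Real.pi + Real.pi / m := by
      rw [hθ]; field_simp; rw [← hk]; ring
    have e2 : ((k : ℝ) - 1 + 1) * θ = Real.pi - Real.pi / m := by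
      rw [hθ]; field_simp; rw [← hk]; ring
    rw [e1, e2, Real.sin_pi_sub, add_comm Real.pi, Real.sin_add_pi]
    ring
  ext z
  rw [reflection_mul_reflection_pow_apply hf hg m z (2 * Real.cos θ) ht.symm]
  rcases Nat.even_or_odd' m with ⟨k, hk | hk⟩
  · have e1 : ((m : ℤ) - 2) / 2 = k - 1 := by omega
    have e2 : ((m : ℤ) - 1) / 2 = k - 1 := by omega
    have h0 : (S ℝ ((k : ℤ) - 1)).eval (2 * Real.cos θ) = 0 := by
      apply mul_right_cancel₀ hsin
      rw [hS, zero_mul]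
      push_cast
      have : ((k : ℝ) - 1 + 1) * θ = Real.pi := by
        rw [hθ]; field_simp; rw [hk]; push_cast; ring
      rw [this, Real.sin_pi]
    rw [e1, e2, h0]
    simp
  · have e1 : ((m : ℤ) - 1) / 2 = k := by omega
    have e2 : ((m : ℤ) - 3) / 2 = k - 1 := by omega
    have e3 : (m : ℤ) / 2 = k := by omega
    have e4 : ((m : ℤ) - 2) / 2 = k - 1 := by omega
    have h0 := hsum k (by rw [hk]; push_cast; ring)
    rw [e1, e2, e3, e4, h0]
    simp

/-- If the angle between two reflections over `ℝ` with independent roots is `π / m` with `m ≠ 1`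
(where `m = 0` stands for the parabolic case), no smaller positive power of their product
is trivial. -/
theorem Module.reflection_mul_reflection_pow_ne_one {V : Type*} [AddCommGroup V] [Module ℝ V]
    {x y : V} {f g : Dual ℝ V} (hf : f x = 2) (hg : g y = 2) (hxy : LinearIndependent ℝ ![x, y])
    {m : ℕ} (hm : m ≠ 1)
    (hfy : f y = -2 * Real.cos (Real.pi / m)) (hgx : g x = -2 * Real.cos (Real.pi / m))
    {k : ℕ} (hk : 0 < k) (hkm : m ≠ 0 → k < m) :
    (reflection hf * reflection hg) ^ k ≠ 1 := by
  intro h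
  have hx := congrArg (fun e : V ≃ₗ[ℝ] V => e x) h
  have ht : f y * g x - 2 = 2 * Real.cos (2 * (Real.pi / m)) := by
    rw [hfy, hgx, Real.cos_two_mul]; ring
  simp only [reflection_mul_reflection_pow_apply_self hf hg k _ ht.symm, LinearEquiv.coe_one,
    id_eq] at hx
  set t := 2 * Real.cos (2 * (Real.pi / m)) with htdef
  -- Comparing coefficients of x and y: a trivial k-th power forces S_k + S_{k-1} = 1 and S_{k-1} ·
  -- g x = 0 at t.
  obtain ⟨ha, hb⟩ := LinearIndependent.pair_iff.1 hxy
    ((S ℝ k).eval t + (S ℝ (k - 1)).eval t - 1) ((S ℝ (k - 1)).eval t * -g x) (by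
      rw [sub_smul, one_smul]; rw [← sub_eq_zero] at hx; rw [← hx]; abel)
  rcases Nat.eq_zero_or_pos m with rfl | hmpos
  · simp only [CharP.cast_eq_zero, div_zero, mul_zero, Real.cos_zero, mul_one] at htdef hgx
    rw [htdef, S_eval_two, hgx] at hb
    push_cast at hb
    have : (0 : ℝ) < k := by exact_mod_cast hk
    linarith
  have hkm := hkm hmpos.ne'
  have hm0 : (m : ℝ) ≠ 0 := by positivity
  have hm2 : 2 ≤ m := by omega
  rcases hm2.eq_or_lt with rfl | hm3
  · have : k = 1 := by omega
    subst this
    have : t = -2 := by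
      rw [htdef]
      have : 2 * (Real.pi / (2 : ℕ)) = Real.pi := by push_cast; ring
      rw [this, Real.cos_pi]; ring
    rw [this] at ha
    norm_num at ha
  set θ : ℝ := 2 * (Real.pi / m) with hθ
  have hS (k : ℤ) : (S ℝ k).eval t * Real.sin θ = Real.sin ((k + 1) * θ) :=
    S_two_mul_real_cos θ k
  have h3 : (3 : ℝ) ≤ m := by exact_mod_cast hm3
  have hpi := Real.pi_pos
  have hle : Real.pi / m ≤ Real.pi / 3 :=
    div_le_div_of_nonneg_left Real.pi_pos.le (by norm_num) h3
  have hpos : 0 < Real.pi / m := by positivity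
  have hsin : Real.sin θ ≠ 0 :=
    (Real.sin_pos_of_pos_of_lt_pi (by positivity) (by linarith)).ne'
  have hcos : 0 < Real.cos (Real.pi / m) :=
    Real.cos_pos_of_mem_Ioo ⟨by linarith, by linarith⟩
  have hS0 : (S ℝ ((k : ℤ) - 1)).eval t = 0 := by
    rcases mul_eq_zero.1 hb with h | h
    · exact h
    · rw [hgx] at h; linarith
  have hk2 : Real.sin (k * θ) = 0 := by
    have := hS (k - 1)
    rw [hS0, zero_mul] at this
    push_cast at this
    rw [this]; congr 1; ring
  obtain ⟨n, hn⟩ := Real.sin_eq_zero_iff.1 hk2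
  have hn' : (n : ℝ) * m = 2 * k := by
    have : (n : ℝ) * Real.pi * m = 2 * k * Real.pi := by
      rw [hn, hθ]; field_simp
    apply mul_right_cancel₀ hpi.ne'
    linarith
  have hn1 : n * m = 2 * k := by exact_mod_cast hn'
  -- From kθ = nπ and 0 < k < m only kθ = π remains; then S_k = 1 would give sin(θ + π) = sin θ.
  have hn2 : n = 1 := by
    have h1 : (0 : ℤ) < n := by
      by_contra hneg
      have : n * (m : ℤ) ≤ 0 := mul_nonpos_of_nonpos_of_nonneg (by omega) (by omega)
      omega
    have h2 : n < 2 := by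
      by_contra hneg
      have : (2 : ℤ) * m ≤ n * m := mul_le_mul_of_nonneg_right (by omega) (by omega)
      omega
    omega
  subst hn2
  have h5 := hS k
  rw [hS0, add_zero, sub_eq_zero] at ha
  rw [ha, one_mul] at h5
  have : ((k : ℤ) + 1 : ℝ) * θ = θ + Real.pi := by
    push_cast
    push_cast at hn
    linarith
  rw [this, Real.sin_add_pi] at h5
  apply hsin
  linarith

end ReflectionOrder

/-! ### The geometric representation and the orders of s_i s_j -/

namespace CoxeterMatrix

open Module

variable {B : Type*} (M : CoxeterMatrix B)

/-- The linear form whose values on the simple roots are the entries of the row `i` of the Cartan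
matrix `-2 cos (π / M i j)`. -/
noncomputable def corootForm (i : B) : Dual ℝ (B →₀ ℝ) :=
  Finsupp.linearCombination ℝ fun j => -2 * Real.cos (Real.pi / M i j)

theorem corootForm_single (i j : B) :
    M.corootForm i (Finsupp.single j 1) = -2 * Real.cos (Real.pi / M i j) := by
  simp [corootForm]

theorem corootForm_single_self (i : B) : M.corootForm i (Finsupp.single i 1) = 2 := by
  simp [corootForm_single]

/-- The simple reflection of the geometric representation. -/
noncomputable def geometricReflection (i : B) : (B →₀ ℝ) ≃ₗ[ℝ] (B →₀ ℝ) :=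
  reflection (M.corootForm_single_self i)

theorem isLiftable_geometricReflection : M.IsLiftable M.geometricReflection := by
  intro i j
  rcases eq_or_ne i j with rfl | hij
  · rw [M.diagonal, pow_one]
    ext1 x
    exact involutive_reflection (M.corootForm_single_self i) x
  · rcases Nat.eq_zero_or_pos (M i j) with h0 | h0
    · rw [h0, pow_zero]
    · have := M.off_diagonal i j hij
      refine reflection_mul_reflection_pow_eq_one _ _ (by omega) (M.corootForm_single i j) ?_
      rw [corootForm_single, M.symmetric j i]

end CoxeterMatrix

namespace CoxeterSystem

variable {B W : Type*} [Group W] {M : CoxeterMatrix B} (cs : CoxeterSystem M W)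

/-- The product of two simple reflections has the order prescribed by the Coxeter matrix. -/
theorem orderOf_simple_mul_simple (i j : B) : orderOf (cs.simple i * cs.simple j) = M i j := by
  rcases eq_or_ne i j with rfl | hij
  · simp
  have key : ∀ k : ℕ, 0 < k → (M i j ≠ 0 → k < M i j) → (cs.simple i * cs.simple j) ^ k ≠ 1 := by
    intro k hk hkm h
    have h1 := congrArg (cs.lift ⟨M.geometricReflection, M.isLiftable_geometricReflection⟩) h
    rw [map_pow, map_mul, map_one, cs.lift_apply_simple, cs.lift_apply_simple] at h1
    refine Module.reflection_mul_reflection_pow_ne_one _ _ ?_ (M.off_diagonal i j hij)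
      (M.corootForm_single i j) (by rw [M.corootForm_single, M.symmetric j i]) hk hkm h1
    rw [LinearIndependent.pair_iff]
    intro a b hab
    have hi := DFunLike.congr_fun hab i
    have hj := DFunLike.congr_fun hab j
    simp [hij, hij.symm] at hi hj
    exact ⟨hi, hj⟩
  rcases Nat.eq_zero_or_pos (M i j) with h0 | h0
  · rw [h0, orderOf_eq_zero_iff']
    exact fun n hn => key n hn fun h => absurd h0 h
  · rw [orderOf_eq_iff h0]
    exact ⟨cs.simple_mul_simple_pow i j, fun k hk hk0 => key k hk0 fun _ => hk⟩

end CoxeterSystem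

/-! ### Inversion parity and deletion -/

namespace CoxeterSystem

open List

variable {B W : Type*} [Group W] {M : CoxeterMatrix B} (cs : CoxeterSystem M W)

section Parity

open scoped Classical in
/-- The action of a simple reflection on pairs of a group element and a sign, where the sign counts
the inversions modulo two. -/
noncomputable def signedConj (i : B) : Function.End (W × ZMod 2) :=
  fun p => (cs.simple i * p.1 * cs.simple i, p.2 + if p.1 = cs.simple i then 1 else 0)

-- The reflections s_j r^k, for r = s_i s_j and k < 2n, are those whose sign is flipped by the
-- successive letters of (s_i s_j)^n, read from the right.
open scoped Classical in
theorem signedConj_mul_pow_apply (i j : B) (n : ℕ) (p : W × ZMod 2) :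
    ((cs.signedConj i * cs.signedConj j) ^ n) p =
      ((cs.simple i * cs.simple j) ^ n * p.1 * ((cs.simple i * cs.simple j) ^ n)⁻¹,
        p.2 + ∑ k ∈ Finset.range (2 * n),
          if p.1 = cs.simple j * (cs.simple i * cs.simple j) ^ k then 1 else 0) := by
  induction n with
  | zero =>
    simp only [pow_zero, one_mul, inv_one, mul_one, mul_zero, Finset.range_zero, Finset.sum_empty,
      add_zero]
    rfl
  | succ n ih =>
    set r := cs.simple i * cs.simple j with hr
    have hrj : ∀ k : ℕ, cs.simple j * r ^ k = (r ^ k)⁻¹ * cs.simple j := by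
      intro k
      induction k with
      | zero => simp
      | succ k ihk =>
        rw [pow_succ, ← mul_assoc, ihk, ← pow_succ, pow_succ' r k, mul_inv_rev, mul_assoc, mul_assoc]
        simp [hr, mul_assoc]
    rw [pow_succ']
    change (cs.signedConj i * cs.signedConj j) (((cs.signedConj i * cs.signedConj j) ^ n) p) = _
    rw [ih]
    change cs.signedConj i (cs.signedConj j _) = _
    simp only [signedConj]
    have e1 : r ^ n * p.1 * (r ^ n)⁻¹ = cs.simple j ↔ p.1 = cs.simple j * r ^ (2 * n) := by
      rw [two_mul, pow_add, ← mul_assoc, hrj, mul_inv_eq_iff_eq_mul]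
      constructor
      · intro h; rw [mul_assoc, ← h]; group
      · intro h; rw [h]; group
    have e2 : cs.simple j * (r ^ n * p.1 * (r ^ n)⁻¹) * cs.simple j = cs.simple i ↔
        p.1 = cs.simple j * r ^ (2 * n + 1) := by
      have h1 : cs.simple j * r ^ (2 * n + 1) =
          (r ^ n)⁻¹ * (cs.simple j * cs.simple i * cs.simple j) * r ^ n := by
        rw [show 2 * n + 1 = n + (1 + n) by ring, pow_add, ← mul_assoc, hrj, pow_add, pow_one, hr]
        simp only [mul_assoc]
      rw [h1]
      constructor
      · intro h
        rw [← h]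
        simp [mul_assoc]
      · intro h
        rw [h]
        simp [mul_assoc]
    rw [Prod.mk.injEq]
    constructor
    · rw [pow_succ', mul_inv_rev, hr]
      simp [mul_assoc]
    · simp only [e1, e2]
      rw [show 2 * (n + 1) = 2 * n + 1 + 1 by ring, Finset.sum_range_succ, Finset.sum_range_succ]
      ring

/-- Since r^m = 1, the terms k and k + m of the sign sum agree and cancel modulo two. -/
theorem isLiftable_signedConj : M.IsLiftable cs.signedConj := by
  classical
  intro i j
  funext p
  rw [signedConj_mul_pow_apply, cs.simple_mul_simple_pow, two_mul, Finset.sum_range_add]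
  simp only [pow_add, cs.simple_mul_simple_pow, one_mul, inv_one, mul_one, CharTwo.add_self_eq_zero,
    add_zero]
  rfl

open scoped Classical in
theorem lift_signedConj_wordProd (ω : List B) (p : W × ZMod 2) :
    cs.lift ⟨cs.signedConj, cs.isLiftable_signedConj⟩ (cs.wordProd ω) p =
      (cs.wordProd ω * p.1 * (cs.wordProd ω)⁻¹, p.2 + (count p.1 (cs.rightInvSeq ω) : ℕ)) := by
  induction ω with
  | nil =>
    simp only [wordProd_nil, map_one, one_mul, inv_one, mul_one, rightInvSeq_nil, count_nil,
      Nat.cast_zero, add_zero]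
    rfl
  | cons i ω ih =>
    rw [wordProd_cons, map_mul, lift_apply_simple]
    change cs.signedConj i (cs.lift ⟨cs.signedConj, cs.isLiftable_signedConj⟩ (cs.wordProd ω) p) = _
    rw [ih, signedConj, rightInvSeq, count_cons, Prod.mk.injEq]
    constructor
    · simp [mul_assoc]
    · have : cs.wordProd ω * p.1 * (cs.wordProd ω)⁻¹ = cs.simple i ↔
          (cs.wordProd ω)⁻¹ * cs.simple i * cs.wordProd ω = p.1 := by
        constructor
        · intro h; rw [← h]; group
        · intro h; rw [← h]; group
      simp only [this, beq_iff_eq]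
      push_cast
      ring

-- The action factors through W, so the parity with which a reflection occurs among the inversions
-- depends only on the product.
open scoped Classical in
theorem count_rightInvSeq_of_wordProd_eq {ω ω' : List B} (h : cs.wordProd ω = cs.wordProd ω')
    (t : W) : (count t (cs.rightInvSeq ω) : ZMod 2) = (count t (cs.rightInvSeq ω') : ℕ) := by
  have h1 := cs.lift_signedConj_wordProd ω (t, 0)
  rw [h, lift_signedConj_wordProd] at h1
  simpa using (congrArg Prod.snd h1).symm

/-- A word whose right inversion sequence has no repetitions is reduced. -/
theorem isReduced_of_nodup_rightInvSeq {ω : List B} (h : (cs.rightInvSeq ω).Nodup) :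
    cs.IsReduced ω := by
  classical
  obtain ⟨ω', hω', heq⟩ := cs.exists_isReduced (cs.wordProd ω)
  -- Each t occurs once, an odd number of times, so it must also occur for the reduced word ω';
  -- comparing lengths finishes.
  have hsub : cs.rightInvSeq ω ⊆ cs.rightInvSeq ω' := by
    intro t ht
    have h1 := cs.count_rightInvSeq_of_wordProd_eq heq t
    rw [count_eq_one_of_mem h ht] at h1
    by_contra hn
    rw [count_eq_zero_of_not_mem hn] at h1
    simp at h1
  have hlen := (subperm_of_subset h hsub).length_le
  rw [length_rightInvSeq, length_rightInvSeq] at hlen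
  refine le_antisymm (cs.length_wordProd_le ω) ?_
  rwa [heq, hω'.eq]

theorem isReduced_of_nodup_leftInvSeq {ω : List B} (h : (cs.leftInvSeq ω).Nodup) :
    cs.IsReduced ω := by
  rw [← isReduced_reverse_iff]
  apply isReduced_of_nodup_rightInvSeq
  rwa [rightInvSeq_reverse, nodup_reverse]

end Parity

/-- Any word has a reduced subword with the same product. -/
theorem exists_sublist_isReduced (ω : List B) :
    ∃ ω' : List B, ω'.Sublist ω ∧ cs.wordProd ω' = cs.wordProd ω ∧ cs.IsReduced ω' := by
  induction h : ω.length using Nat.strong_induction_on generalizing ω with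
  | _ n ih =>
    by_cases hnd : (cs.rightInvSeq ω).Nodup
    · exact ⟨ω, Sublist.refl ω, rfl, cs.isReduced_of_nodup_rightInvSeq hnd⟩
    · rw [nodup_iff_getElem?_ne_getElem?] at hnd
      push Not at hnd
      obtain ⟨j, j', hjj', hj', dup⟩ := hnd
      replace hj' : j' < ω.length := by simpa using hj'
      rw [getElem?_eq_getElem (by simp; omega), getElem?_eq_getElem (by simp; omega)] at dup
      apply Option.some_injective at dup
      rw [← getD_eq_getElem _ 1, ← getD_eq_getElem _ 1] at dup
      -- An entry of the right inversion sequence depends only on the letters from its position on;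
      -- deleting letter j < j' merely shifts j' to j' - 1.
      have h₃ : (cs.rightInvSeq (ω.eraseIdx j)).getD (j' - 1) 1 =
          (cs.rightInvSeq ω).getD j' 1 := by
        clear ih dup
        grind only [cs.getD_rightInvSeq, = eraseIdx_eq_take_drop_succ, = getElem?_eraseIdx,
          = drop_append, drop_of_length_le, drop_drop, = length_append, = length_take,
          = length_drop, = min_def]
      -- Each deletion multiplies by the corresponding inversion; two equal involutions cancel.
      have h₅ : cs.wordProd ((ω.eraseIdx j).eraseIdx (j' - 1)) = cs.wordProd ω := by
        rw [← wordProd_mul_getD_rightInvSeq, h₃, ← wordProd_mul_getD_rightInvSeq, dup, mul_assoc,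
          getD_rightInvSeq_mul_self, mul_one]
      have hlt : ((ω.eraseIdx j).eraseIdx (j' - 1)).length < n := by grind
      obtain ⟨ω', hs, hp, hr⟩ := ih _ hlt _ rfl
      exact ⟨ω', hs.trans ((eraseIdx_sublist _ _).trans (eraseIdx_sublist _ _)), hp.trans h₅, hr⟩

/-! ### Parabolic cosets -/

theorem leftInvSeq_append (ω ω' : List B) :
    cs.leftInvSeq (ω ++ ω') =
      cs.leftInvSeq ω ++ (cs.leftInvSeq ω').map (MulAut.conj (cs.wordProd ω)) := by
  induction ω with
  | nil => simp
  | cons i ω ih =>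
    rw [cons_append, leftInvSeq, ih, leftInvSeq, map_append, cons_append, map_map, wordProd_cons,
      map_mul]
    rfl

/-- The standard parabolic subgroup generated by the simple reflections in `J`. -/
def parabolic (J : Set B) : Subgroup W := Subgroup.closure (cs.simple '' J)

theorem wordProd_mem_parabolic {J : Set B} {ω : List B} (h : ∀ i ∈ ω, i ∈ J) :
    cs.wordProd ω ∈ cs.parabolic J := by
  apply Subgroup.list_prod_mem
  intro x hx
  obtain ⟨i, hi, rfl⟩ := mem_map.1 hx
  exact Subgroup.subset_closure ⟨i, h i hi, rfl⟩

theorem exists_isReduced_of_mem_parabolic {J : Set B} {u : W} (hu : u ∈ cs.parabolic J) :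
    ∃ ω : List B, (∀ i ∈ ω, i ∈ J) ∧ cs.wordProd ω = u ∧ cs.IsReduced ω := by
  suffices ∃ ω : List B, (∀ i ∈ ω, i ∈ J) ∧ cs.wordProd ω = u by
    obtain ⟨ω, h1, h2⟩ := this
    obtain ⟨ω', h3, h4, h5⟩ := cs.exists_sublist_isReduced ω
    exact ⟨ω', fun i hi => h1 i (h3.subset hi), h4.trans h2, h5⟩
  induction hu using Subgroup.closure_induction with
  | mem x hx =>
    obtain ⟨i, hi, rfl⟩ := hx
    exact ⟨[i], by simpa using hi, by simp⟩
  | one => exact ⟨[], by simp, by simp⟩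
  | mul x y _ _ hx hy =>
    obtain ⟨ω, h1, rfl⟩ := hx
    obtain ⟨ω', h1', rfl⟩ := hy
    refine ⟨ω ++ ω', ?_, cs.wordProd_append ω ω'⟩
    intro i hi
    rcases mem_append.1 hi with h | h
    exacts [h1 i h, h1' i h]
  | inv x _ hx =>
    obtain ⟨ω, h1, rfl⟩ := hx
    exact ⟨ω.reverse, by simpa using h1, by simp⟩

theorem mem_parabolic_of_mem_leftInvSeq {J : Set B} {ω : List B} (h : ∀ i ∈ ω, i ∈ J) {t : W}
    (ht : t ∈ cs.leftInvSeq ω) : t ∈ cs.parabolic J := by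
  obtain ⟨k, hk, rfl⟩ := mem_iff_getElem.1 ht
  rw [length_leftInvSeq] at hk
  rw [getElem_leftInvSeq cs ω k hk]
  have h1 : cs.wordProd (ω.take k) ∈ cs.parabolic J :=
    cs.wordProd_mem_parabolic fun i hi => h i (mem_of_mem_take hi)
  exact mul_mem (mul_mem h1 (Subgroup.subset_closure ⟨_, h _ (getElem_mem hk), rfl⟩)) (inv_mem h1)

/-- If `v` is of minimal length in its coset of a standard parabolic subgroup, lengths add. -/
theorem length_wordProd_mul_of_forall_le {J : Set B} {v : W}
    (hv : ∀ u ∈ cs.parabolic J, cs.length v ≤ cs.length (u * v)) {ω : List B}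
    (hω : cs.IsReduced ω) (hJ : ∀ i ∈ ω, i ∈ J) :
    cs.length (cs.wordProd ω * v) = ω.length + cs.length v := by
  obtain ⟨χ, hχ, rfl⟩ := cs.exists_isReduced v
  rw [← wordProd_append, hχ.eq, ← length_append]
  apply IsReduced.eq
  apply isReduced_of_nodup_leftInvSeq
  rw [leftInvSeq_append, nodup_append']
  refine ⟨hω.nodup_leftInvSeq, hχ.nodup_leftInvSeq.map (MulAut.conj _).injective, ?_⟩
  intro t ht ht'
  obtain ⟨r, hr, rfl⟩ := mem_map.1 ht'
  have h1 := cs.mem_parabolic_of_mem_leftInvSeq hJ ht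
  have h2 := cs.wordProd_mem_parabolic hJ
  have h3 : r ∈ cs.parabolic J := by
    have := mul_mem (mul_mem (inv_mem h2) h1) h2
    simpa [mul_assoc] using this
  -- A repeated inversion would yield a reflection r of the parabolic subgroup that shortens v.
  exact absurd (hv r h3) (not_le.2 (cs.isLeftInversion_of_mem_leftInvSeq hχ hr).2)

/-- If no element of `J` is a left descent of `v`, lengths add in products `u * v` with `u` in the
standard parabolic subgroup of `J`. -/
theorem length_wordProd_mul {J : Set B} {v : W} (hv : ∀ i ∈ J, ¬ cs.IsLeftDescent v i)
    {ω : List B} (hω : cs.IsReduced ω) (hJ : ∀ i ∈ ω, i ∈ J) :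
    cs.length (cs.wordProd ω * v) = ω.length + cs.length v := by
  apply cs.length_wordProd_mul_of_forall_le _ hω hJ
  set f : cs.parabolic J → ℕ := fun u => cs.length (u * v) with hf
  obtain ⟨u, hu⟩ : ∃ u, ∀ u', f u ≤ f u' := ⟨Function.argmin f, fun u' => Function.argmin_le f u'⟩
  set v₀ := (u : W) * v with hv₀
  have hmin : ∀ u' ∈ cs.parabolic J, cs.length v₀ ≤ cs.length (u' * v₀) := by
    intro u' hu'
    rw [hv₀, ← mul_assoc]
    exact hu ⟨u' * u, mul_mem hu' u.2⟩
  have hvv : v = (u : W)⁻¹ * v₀ := by rw [hv₀, inv_mul_cancel_left]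
  obtain ⟨χ, h1, h2, h3⟩ := cs.exists_isReduced_of_mem_parabolic (inv_mem u.2)
  rcases χ with _ | ⟨i, χ⟩
  · rw [wordProd_nil] at h2
    rwa [hvv, ← h2, one_mul]
  -- If v differs from the minimal coset representative v₀, the first letter of a reduced word for
  -- u⁻¹ is a left descent of v.
  · exfalso
    apply hv i (h1 i mem_cons_self)
    have h4 := cs.length_wordProd_mul_of_forall_le hmin h3 h1
    have h5 : cs.simple i * v = cs.wordProd χ * v₀ := by
      rw [hvv, ← h2, wordProd_cons]; simp [mul_assoc]
    rw [IsLeftDescent, h5, hvv, ← h2, h4, length_cons]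
    have h6 := cs.length_mul_le (cs.wordProd χ) v₀
    have h7 := cs.length_wordProd_le χ
    omega

end CoxeterSystem

/-- A local criterion for the existence of a greatest element above `x` in a set `X` with respect
to the order generated by a relation `r` along which a bounded rank function increases. -/
theorem Relation.ReflTransGen.exists_greatest {α : Type*} {r : α → α → Prop} {X : Set α}
    {f : α → ℕ} {N : ℕ} (hf : ∀ x y, r x y → f x < f y) (hN : ∀ x ∈ X, f x ≤ N)
    (hX : ∀ x y, r x y → y ∈ X → x ∈ X)
    (hr : ∀ x y z, x ∈ X → y ∈ X → z ∈ X → r x y → r x z →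
      ∃ w ∈ X, Relation.ReflTransGen r y w ∧ Relation.ReflTransGen r z w)
    {x : α} (hx : x ∈ X) :
    ∃ n ∈ X, ∀ y ∈ X, Relation.ReflTransGen r x y → Relation.ReflTransGen r y n := by
  have hX' : ∀ x y, Relation.ReflTransGen r x y → y ∈ X → x ∈ X := by
    intro x y h
    induction h with
    | refl => exact id
    | tail _ h ih => exact fun hy => ih (hX _ _ h hy)
  induction hk : N - f x using Nat.strong_induction_on generalizing x with
  | _ k ih =>
    by_cases h : ∃ y ∈ X, r x y
    · obtain ⟨y, hy, hxy⟩ := h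
      have hlt : ∀ y ∈ X, r x y → N - f y < k := fun y hy hxy => by
        have := hf x y hxy
        have := hN y hy
        omega
      obtain ⟨n, hn, hyn⟩ := ih _ (hlt y hy hxy) hy rfl
      refine ⟨n, hn, fun z hz hxz => ?_⟩
      rcases Relation.ReflTransGen.cases_head hxz with rfl | ⟨u, hxu, huz⟩
      · exact .head hxy (hyn y hy .refl)
      · have hu := hX' _ _ huz hz
        obtain ⟨n', hn', hun'⟩ := ih _ (hlt u hu hxu) hu rfl
        obtain ⟨w, hw, hyw, huw⟩ := hr x y u hx hy hu hxy hxu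
        exact (hun' z hz huz).trans (hyn n' hn' (hyw.trans (hun' w hw huw)))
    · refine ⟨x, hx, fun y hy hxy => ?_⟩
      rcases Relation.ReflTransGen.cases_head hxy with rfl | ⟨u, hxu, huy⟩
      · exact .refl
      · exact absurd ⟨u, hX' _ _ huy hy, hxu⟩ h

/-! ### Alternating words -/

section AltWord

variable {B : Type*}

theorem length_toList_altWord (a b : B) (m : ℕ) : (altWord a b m).toList.length = m := by
  induction m generalizing a b with
  | zero => rfl
  | succ m ih => simp [altWord, ih]

theorem toList_altWord_succ (a b : B) (m : ℕ) :
    (altWord a b (m + 1)).toList = a :: (altWord b a m).toList := by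
  simp [altWord]

theorem mem_toList_altWord {a b i : B} {m : ℕ} (h : i ∈ (altWord a b m).toList) :
    i = a ∨ i = b := by
  induction m generalizing a b with
  | zero => simp [altWord] at h
  | succ m ih =>
    rw [toList_altWord_succ, List.mem_cons] at h
    rcases h with h | h
    · exact .inl h
    · exact (ih h).symm

theorem toList_altWord (a b : B) (m : ℕ) :
    (altWord a b m).toList = (CoxeterSystem.alternatingWord b a m).reverse := by
  induction m generalizing a b with
  | zero => rfl
  | succ m ih => simp [toList_altWord_succ, CoxeterSystem.alternatingWord_succ, ih]

theorem reverse_toList_altWord (a b : B) (m : ℕ) :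
    (altWord a b m).toList.reverse =
      if Even m then (altWord b a m).toList else (altWord a b m).toList := by
  induction m generalizing a b with
  | zero => rfl
  | succ m ih =>
    have h : (altWord a b (m + 1)).toList.reverse =
        (if Even m then a else b) :: (altWord a b m).toList.reverse := by
      rw [toList_altWord, toList_altWord, List.reverse_reverse, List.reverse_reverse,
        CoxeterSystem.alternatingWord_succ']
    rw [h, ih]
    by_cases hm : Even m <;>
      simp [hm, toList_altWord_succ, Nat.even_add_one, -Nat.not_even_iff_odd]

theorem exists_altWord_add (a b : B) (m n : ℕ) :
    ∃ u, (altWord a b (m + n)).toList = (altWord a b m).toList ++ u ∧ u.length = n := by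
  induction m generalizing a b with
  | zero => exact ⟨_, by rw [zero_add]; rfl, length_toList_altWord a b n⟩
  | succ m ih =>
    obtain ⟨u, h, hu⟩ := ih b a
    exact ⟨u, by rw [Nat.add_right_comm, toList_altWord_succ, h, toList_altWord_succ]; rfl, hu⟩

end AltWord

/-! ### Braid words in the Coxeter group -/

namespace CoxeterSystem

open List

variable {B W : Type*} [Group W] {M : CoxeterMatrix B} (cs : CoxeterSystem M W)

/-- The k-th entry is a fixed simple reflection times the k-th power of s_j s_i, and powers below
the order `M i j` are distinct. -/
theorem nodup_take_leftInvSeq_alternatingWord (i j : B) {m : ℕ} (hm : M i j ≠ 0 → m ≤ M i j) :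
    ((cs.leftInvSeq (alternatingWord i j (2 * m))).take m).Nodup := by
  rw [nodup_iff_injective_getElem]
  rintro ⟨k, hk⟩ ⟨k', hk'⟩ h
  simp only [length_take, length_leftInvSeq, length_alternatingWord] at hk hk'
  have hk : k < m := by omega
  have hk' : k' < m := by omega
  simp only [getElem_take] at h
  rw [getElem_leftInvSeq_alternatingWord cs i j m k (by omega),
    getElem_leftInvSeq_alternatingWord cs i j m k' (by omega),
    prod_alternatingWord_eq_mul_pow, prod_alternatingWord_eq_mul_pow] at h
  have e (n : ℕ) : (2 * n + 1) / 2 = n := by omega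
  have e' (n : ℕ) : ¬ Even (2 * n + 1) := by simp
  simp only [e, e', if_false, mul_right_inj] at h
  rw [Fin.mk.injEq]
  have ho := cs.orderOf_simple_mul_simple j i
  rw [M.symmetric j i] at ho
  by_cases h0 : M i j = 0
  · rw [h0] at ho
    exact (injective_pow_iff_not_isOfFinOrder.2 (orderOf_eq_zero_iff.1 ho)) h
  · exact pow_injOn_Iio_orderOf (by rw [ho]; exact hk.trans_le (hm h0))
      (by rw [ho]; exact hk'.trans_le (hm h0)) h

theorem isReduced_alternatingWord (i j : B) {m : ℕ} (hm : M i j ≠ 0 → m ≤ M i j) :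
    cs.IsReduced (alternatingWord i j m) := by
  rcases Nat.eq_zero_or_pos m with rfl | h0
  · simp [alternatingWord, IsReduced]
  apply isReduced_of_nodup_leftInvSeq
  by_cases he : Even m
  · have h1 := cs.nodup_take_leftInvSeq_alternatingWord i j hm
    rwa [← leftInvSeq_take, listTake_alternatingWord i j m m (by omega), if_pos he] at h1
  · have h1 := cs.nodup_take_leftInvSeq_alternatingWord j i (m := m) (by rwa [M.symmetric])
    rwa [← leftInvSeq_take, listTake_alternatingWord j i m m (by omega), if_neg he] at h1

theorem isReduced_altWord (a b : B) {m : ℕ} (hm : M a b ≠ 0 → m ≤ M a b) :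
    cs.IsReduced (altWord a b m).toList := by
  rw [toList_altWord, isReduced_reverse_iff]
  exact cs.isReduced_alternatingWord b a (by rwa [M.symmetric])

theorem wordProd_altWord_swap (a b : B) :
    cs.wordProd (altWord a b (M a b)).toList = cs.wordProd (altWord b a (M a b)).toList := by
  rw [toList_altWord, toList_altWord, wordProd_reverse, wordProd_reverse]
  congr 1
  have := cs.wordProd_braidWord_eq a b
  rw [braidWord, braidWord, M.symmetric b a] at this
  exact this.symm

/-- Left multiplication by alternating words of admissible length adds lengths if neither letter is
a left descent. -/
theorem length_altWord_mul {a b : B} {v : W} (ha : ¬ cs.IsLeftDescent v a)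
    (hb : ¬ cs.IsLeftDescent v b) {m : ℕ} (hm : M a b ≠ 0 → m ≤ M a b) :
    cs.length (cs.wordProd (altWord a b m).toList * v) = m + cs.length v := by
  have := cs.length_wordProd_mul (J := {a, b}) (v := v) (by simp [ha, hb])
    (cs.isReduced_altWord a b hm) fun i hi => mem_toList_altWord hi
  rwa [length_toList_altWord] at this

theorem length_mul_altWord {a b : B} {v : W} (ha : ¬ cs.IsRightDescent v a)
    (hb : ¬ cs.IsRightDescent v b) {m : ℕ} (hm : M a b ≠ 0 → m ≤ M a b) :
    cs.length (v * cs.wordProd (altWord a b m).toList) = cs.length v + m := by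
  rw [← isLeftDescent_inv_iff] at ha hb
  have := cs.length_wordProd_mul (J := {a, b}) (v := v⁻¹) (by simp [ha, hb])
    (cs.isReduced_altWord a b hm).reverse fun i hi => mem_toList_altWord (mem_reverse.1 hi)
  rw [length_reverse, length_toList_altWord, wordProd_reverse, ← mul_inv_rev, length_inv,
    length_inv] at this
  omega

/-- After a is stripped it is no longer a descent, so only b can follow; the letters alternate until
neither is a descent. -/
theorem exists_maximal_altWord_mul {w : W} {a : B} (b : B) (ha : cs.IsLeftDescent w a) :
    ∃ k v, w = cs.wordProd (altWord a b k).toList * v ∧ cs.length w = k + cs.length v ∧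
      ¬ cs.IsLeftDescent v a ∧ ¬ cs.IsLeftDescent v b := by
  induction h : cs.length w using Nat.strong_induction_on generalizing w a b with
  | _ n ih =>
    have h1 := cs.isLeftDescent_iff.1 ha
    have h2 : ¬ cs.IsLeftDescent (cs.simple a * w) a :=
      cs.isLeftDescent_iff_not_isLeftDescent_mul.1 ha
    by_cases hb : cs.IsLeftDescent (cs.simple a * w) b
    · obtain ⟨k, v, hw, hl, hvb, hva⟩ := ih _ (by omega) a hb rfl
      refine ⟨k + 1, v, ?_, by omega, hva, hvb⟩
      rw [toList_altWord_succ, wordProd_cons, mul_assoc, ← hw, simple_mul_simple_cancel_left]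
    · refine ⟨1, cs.simple a * w, ?_, by omega, h2, hb⟩
      simp [altWord]

/-- An element with two distinct left descents starts with the corresponding braid word. -/
theorem exists_eq_altWord_mul {w : W} {a b : B} (ha : cs.IsLeftDescent w a)
    (hb : cs.IsLeftDescent w b) :
    M a b ≠ 0 ∧ ∃ v, w = cs.wordProd (altWord a b (M a b)).toList * v ∧
      cs.length w = M a b + cs.length v := by
  obtain ⟨k, v, hw, hl, hva, hvb⟩ := cs.exists_maximal_altWord_mul b ha
  by_cases hk : M a b ≠ 0 ∧ M a b ≤ k
  · refine ⟨hk.1, ?_⟩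
    obtain ⟨u, hu, hul⟩ := exists_altWord_add a b (M a b) (k - M a b)
    rw [Nat.add_sub_cancel' hk.2] at hu
    refine ⟨cs.wordProd u * v, by rw [hw, hu, wordProd_append, mul_assoc], ?_⟩
    have h1 := cs.length_mul_le (cs.wordProd u) v
    have h2 := cs.length_wordProd_le u
    have h3 := cs.length_mul_le (cs.wordProd (altWord a b (M a b)).toList) (cs.wordProd u * v)
    have h4 := cs.length_wordProd_le (altWord a b (M a b)).toList
    rw [length_toList_altWord] at h4
    rw [← mul_assoc, ← wordProd_append, ← hu, ← hw] at h3
    omega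
  -- If the stripped word is shorter than the braid word, putting b in front gives an admissible
  -- alternating word, so lengths add and b is not a descent of w.
  · exfalso
    have h1 := cs.length_altWord_mul hvb hva (m := k + 1) (by rw [M.symmetric]; omega)
    rw [toList_altWord_succ, wordProd_cons, mul_assoc, ← hw] at h1
    rw [isLeftDescent_iff] at hb
    omega

/-! ### The weak order and greatest prefixes -/

/-- The product `u * v` is reduced: lengths add. -/
def IsReducedMul (u v : W) : Prop := cs.length (u * v) = cs.length u + cs.length v

/-- `v` is a prefix of `w`: it is smaller in the weak order. -/
def IsPrefix (v w : W) : Prop := cs.IsReducedMul v (v⁻¹ * w)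

variable {cs} in
theorem IsReducedMul.assoc_left {u v w : W} (h1 : cs.IsReducedMul u v)
    (h2 : cs.IsReducedMul (u * v) w) : cs.IsReducedMul v w ∧ cs.IsReducedMul u (v * w) := by
  have h3 := cs.length_mul_le v w
  have h4 := cs.length_mul_le u (v * w)
  simp only [IsReducedMul, mul_assoc] at *
  omega

variable {cs} in
theorem IsReducedMul.assoc_right {u v w : W} (h1 : cs.IsReducedMul v w)
    (h2 : cs.IsReducedMul u (v * w)) : cs.IsReducedMul u v ∧ cs.IsReducedMul (u * v) w := by
  have h3 := cs.length_mul_le u v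
  have h4 := cs.length_mul_le (u * v) w
  simp only [IsReducedMul, mul_assoc] at *
  omega

theorem isPrefix_iff {v w : W} : cs.IsPrefix v w ↔ ∃ u, w = v * u ∧ cs.IsReducedMul v u := by
  constructor
  · exact fun h => ⟨v⁻¹ * w, by simp, h⟩
  · rintro ⟨u, rfl, h⟩
    rwa [IsPrefix, inv_mul_cancel_left]

theorem isPrefix_refl (w : W) : cs.IsPrefix w w := by simp [IsPrefix, IsReducedMul]

theorem isPrefix_one (w : W) : cs.IsPrefix 1 w := by simp [IsPrefix, IsReducedMul]

variable {cs} in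
theorem IsPrefix.trans {u v w : W} (h1 : cs.IsPrefix u v) (h2 : cs.IsPrefix v w) :
    cs.IsPrefix u w := by
  obtain ⟨x, rfl, hx⟩ := cs.isPrefix_iff.1 h1
  obtain ⟨y, rfl, hy⟩ := cs.isPrefix_iff.1 h2
  exact cs.isPrefix_iff.2 ⟨x * y, by rw [mul_assoc], (hx.assoc_left hy).2⟩

variable {cs} in
theorem IsPrefix.antisymm {u v : W} (h1 : cs.IsPrefix u v) (h2 : cs.IsPrefix v u) : u = v := by
  obtain ⟨x, rfl, hx⟩ := cs.isPrefix_iff.1 h1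
  obtain ⟨y, hy, hy'⟩ := cs.isPrefix_iff.1 h2
  have : cs.length x = 0 := by
    rw [IsReducedMul, ← hy] at hy'
    rw [IsReducedMul] at hx
    omega
  rw [cs.length_eq_zero_iff.1 this, mul_one]

variable {cs} in
theorem IsPrefix.length_le {u v : W} (h : cs.IsPrefix u v) : cs.length u ≤ cs.length v := by
  obtain ⟨x, rfl, hx⟩ := cs.isPrefix_iff.1 h
  rw [hx]
  exact Nat.le_add_right _ _

variable {cs} in
theorem IsReducedMul.of_isPrefix {u v w : W} (h : cs.IsReducedMul u w) (hv : cs.IsPrefix v w) :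
    cs.IsReducedMul u v := by
  obtain ⟨x, rfl, hx⟩ := cs.isPrefix_iff.1 hv
  exact (hx.assoc_right h).1

/-- The covering relation of the weak order. -/
def WeakCover (v w : W) : Prop := ∃ b, w = v * cs.simple b ∧ cs.length w = cs.length v + 1

theorem isPrefix_iff_reflTransGen {v w : W} :
    cs.IsPrefix v w ↔ Relation.ReflTransGen cs.WeakCover v w := by
  constructor
  · intro h
    obtain ⟨u, rfl, hu⟩ := cs.isPrefix_iff.1 h
    clear h
    induction hn : cs.length u generalizing u with
    | zero => rw [cs.length_eq_zero_iff.1 hn, mul_one]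
    | succ n ih =>
      have h1 : u ≠ 1 := by rintro rfl; simp at hn
      obtain ⟨b, hb⟩ := cs.exists_rightDescent_of_ne_one h1
      rw [isRightDescent_iff] at hb
      have h2 : cs.IsReducedMul (u * cs.simple b) (cs.simple b) := by
        rw [IsReducedMul, simple_mul_simple_cancel_right, length_simple, hb]
      have h3 := h2.assoc_right (u := v) (by rwa [simple_mul_simple_cancel_right])
      refine .tail (ih _ h3.1 (by omega)) ⟨b, ?_, ?_⟩
      · rw [← mul_assoc, simple_mul_simple_cancel_right]
      · rw [h3.1, hu]; omega
  · intro h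
    induction h with
    | refl => exact cs.isPrefix_refl v
    | tail _ h ih =>
      obtain ⟨b, rfl, hl⟩ := h
      exact ih.trans (cs.isPrefix_iff.2 ⟨_, rfl, by rw [IsReducedMul, hl, length_simple]⟩)

theorem weakCover_mul_simple {x : W} {b : B} (h : ¬ cs.IsRightDescent x b) :
    cs.WeakCover x (x * cs.simple b) := ⟨b, rfl, cs.not_isRightDescent_iff.1 h⟩

/-- Two distinct covers of an element have the braid element as an upper bound. -/
theorem isPrefix_mul_altWord {x : W} {b c : B} (hb : ¬ cs.IsRightDescent x b)
    (hc : ¬ cs.IsRightDescent x c) (h0 : M b c ≠ 0) :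
    cs.IsPrefix (x * cs.simple b) (x * cs.wordProd (altWord b c (M b c)).toList) := by
  obtain ⟨m, hm⟩ := Nat.exists_eq_succ_of_ne_zero h0
  have h1 := cs.length_mul_altWord hb hc (m := M b c) fun _ => le_rfl
  rw [isPrefix_iff]
  rw [hm, toList_altWord_succ, wordProd_cons, ← mul_assoc] at h1 ⊢
  refine ⟨_, rfl, ?_⟩
  have h2 := cs.length_mul_le (x * cs.simple b) (cs.wordProd (altWord c b m).toList)
  have h3 := cs.length_wordProd_le (altWord c b m).toList
  rw [length_toList_altWord] at h3
  have h4 := cs.not_isRightDescent_iff.1 hb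
  rw [IsReducedMul]
  omega

/-- A bounded set of elements that is closed under prefixes and under braid elements has a greatest
element in the weak order. -/
theorem exists_greatest_prefix {X : Set W} {N : ℕ} (hN : ∀ x ∈ X, cs.length x ≤ N)
    (h1 : 1 ∈ X) (hX : ∀ x y, cs.IsPrefix x y → y ∈ X → x ∈ X)
    (hb : ∀ x b c, b ≠ c → x * cs.simple b ∈ X → x * cs.simple c ∈ X →
      ¬ cs.IsRightDescent x b → ¬ cs.IsRightDescent x c →
      M b c ≠ 0 ∧ x * cs.wordProd (altWord b c (M b c)).toList ∈ X) :
    ∃ n ∈ X, ∀ y ∈ X, cs.IsPrefix y n := by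
  obtain ⟨n, hn, h⟩ := Relation.ReflTransGen.exists_greatest (r := cs.WeakCover) (X := X)
    (f := cs.length) (N := N) (fun x y h => by obtain ⟨_, _, h⟩ := h; omega) hN
    (fun x y h hy => hX x y (cs.isPrefix_iff_reflTransGen.2 (.single h)) hy)
    (by
      rintro x _ _ hx hy hz ⟨b, rfl, hyl⟩ ⟨c, rfl, hzl⟩
      by_cases hbc : b = c
      · subst hbc
        exact ⟨_, hy, .refl, .refl⟩
      rw [← not_isRightDescent_iff] at hyl hzl
      obtain ⟨h0, hmem⟩ := hb x b c hbc hy hz hyl hzl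
      refine ⟨_, hmem, cs.isPrefix_iff_reflTransGen.1 (cs.isPrefix_mul_altWord hyl hzl h0),
        cs.isPrefix_iff_reflTransGen.1 ?_⟩
      rw [wordProd_altWord_swap, M.symmetric]
      exact cs.isPrefix_mul_altWord hzl hyl (by rwa [M.symmetric])) h1
  exact ⟨n, hn, fun y hy => cs.isPrefix_iff_reflTransGen.2
    (h y hy (cs.isPrefix_iff_reflTransGen.1 (cs.isPrefix_one y)))⟩

/-- `v` is the greatest prefix of `w` whose product with `u` is reduced. -/
structure IsGreatestPrefix (u w v : W) : Prop where
  isPrefix : cs.IsPrefix v w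
  isReducedMul : cs.IsReducedMul u v
  isPrefix_of_isReducedMul : ∀ x, cs.IsPrefix x w → cs.IsReducedMul u x → cs.IsPrefix x v

variable {cs} in
theorem IsGreatestPrefix.eq {u w v v' : W} (h : cs.IsGreatestPrefix u w v)
    (h' : cs.IsGreatestPrefix u w v') : v = v' :=
  (h'.3 v h.1 h.2).antisymm (h.3 v' h'.1 h'.2)

theorem isLeftDescent_of_isPrefix {x w : W} {b : B} (h : cs.IsPrefix (x * cs.simple b) w)
    (hx : ¬ cs.IsRightDescent x b) : cs.IsLeftDescent (x⁻¹ * w) b := by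
  obtain ⟨u, rfl, hu⟩ := cs.isPrefix_iff.1 h
  rw [not_isRightDescent_iff] at hx
  have h1 : cs.IsReducedMul x (cs.simple b) := by rw [IsReducedMul, hx, length_simple]
  have h2 := (h1.assoc_left hu).1
  rw [IsReducedMul, length_simple] at h2
  rw [isLeftDescent_iff, mul_assoc, inv_mul_cancel_left, simple_mul_simple_cancel_left]
  omega

/-- If xs_b and xs_c are admissible, x⁻¹w has descents b and c, hence starts with their braid word;
and s_a x has neither as a right descent, so appending that word keeps lengths additive. -/
theorem exists_isGreatestPrefix (a : B) (w : W) :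
    ∃ v, cs.IsGreatestPrefix (cs.simple a) w v := by
  obtain ⟨v, hv, h⟩ := cs.exists_greatest_prefix
    (X := {x | cs.IsPrefix x w ∧ cs.IsReducedMul (cs.simple a) x}) (N := cs.length w)
    (fun x hx => hx.1.length_le) ⟨cs.isPrefix_one w, by simp [IsReducedMul]⟩
    (fun x y h hy => ⟨h.trans hy.1, hy.2.of_isPrefix h⟩) (by
      rintro x b c hbc ⟨hb, hb'⟩ ⟨hc, hc'⟩ hxb hxc
      obtain ⟨h0, v, hv, hvl⟩ := cs.exists_eq_altWord_mul
        (cs.isLeftDescent_of_isPrefix hb hxb)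
        (cs.isLeftDescent_of_isPrefix hc hxc)
      have hpre (d : B) (hd : ¬ cs.IsRightDescent x d) : cs.IsPrefix x (x * cs.simple d) :=
        cs.isPrefix_iff_reflTransGen.2 (.single (cs.weakCover_mul_simple hd))
      have hax : cs.IsReducedMul (cs.simple a) x := hb'.of_isPrefix (hpre b hxb)
      have hasc (d : B) (hd : ¬ cs.IsRightDescent x d)
          (h : cs.IsReducedMul (cs.simple a) (x * cs.simple d)) :
          ¬ cs.IsRightDescent (cs.simple a * x) d := by
        rw [not_isRightDescent_iff] at hd ⊢
        rw [mul_assoc, h, hd, hax]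
        ring
      have hxl := cs.length_mul_altWord hxb hxc (m := M b c) fun _ => le_rfl
      have haxl := cs.length_mul_altWord (hasc b hxb hb') (hasc c hxc hc') (m := M b c)
        fun _ => le_rfl
      refine ⟨h0, ?_, ?_⟩
      · have hxw := (hpre b hxb).trans hb
        rw [IsPrefix, IsReducedMul, mul_inv_cancel_left] at hxw
        refine cs.isPrefix_iff.2 ⟨v, by rw [mul_assoc, ← hv, mul_inv_cancel_left], ?_⟩
        rw [IsReducedMul, mul_assoc, ← hv, mul_inv_cancel_left]
        omega
      · rw [IsReducedMul, ← mul_assoc]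
        rw [IsReducedMul] at hax
        omega)
  exact ⟨v, hv.1, hv.2, fun x h1 h2 => h x ⟨h1, h2⟩⟩

/-- In a finite Coxeter group, all elements are prefixes of a longest element. -/
theorem exists_forall_isPrefix [Finite W] : ∃ w₀ : W, ∀ w, cs.IsPrefix w w₀ := by
  obtain ⟨N, hN⟩ := (Set.finite_range cs.length).bddAbove
  obtain ⟨n, -, h⟩ := cs.exists_greatest_prefix (X := Set.univ) (N := N)
    (fun x _ => hN ⟨x, rfl⟩) trivial (fun _ _ _ _ => trivial) (fun x b c _ _ _ _ _ => by
      refine ⟨?_, trivial⟩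
      -- Elements of a finite group have finite order, so no entry of `M` is infinite.
      rw [← cs.orderOf_simple_mul_simple]
      exact (orderOf_pos _).ne')
  exact ⟨n, fun w => h w trivial⟩

end CoxeterSystem

/-! ### Artin monoid: words, length, reversal -/

namespace ArtinMonoid

variable {B : Type*} (M : CoxeterMatrix B)

/-- The standard generator of the Artin monoid with index `a`. -/
def gen (a : B) : ArtinMonoid M := PresentedMonoid.of (ArtinRel M) a

/-- The element of the Artin monoid represented by a word. -/
def ofWord (ω : List B) : ArtinMonoid M := PresentedMonoid.mk (ArtinRel M) (FreeMonoid.ofList ω)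

theorem ofWord_nil : ofWord M [] = 1 := map_one (PresentedMonoid.mk (ArtinRel M))

theorem ofWord_cons (a : B) (ω : List B) : ofWord M (a :: ω) = gen M a * ofWord M ω :=
  map_mul (PresentedMonoid.mk (ArtinRel M)) (FreeMonoid.of a) (FreeMonoid.ofList ω)

theorem ofWord_append (ω ω' : List B) : ofWord M (ω ++ ω') = ofWord M ω * ofWord M ω' :=
  map_mul (PresentedMonoid.mk (ArtinRel M)) (FreeMonoid.ofList ω) (FreeMonoid.ofList ω')

theorem ofWord_altWord_swap (a b : B) :
    ofWord M (altWord a b (M a b)).toList = ofWord M (altWord b a (M a b)).toList :=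
  PresentedMonoid.mk_eq_mk_of_rel (.braid a b)

variable {M}

theorem exists_ofWord_eq (x : ArtinMonoid M) : ∃ ω, ofWord M ω = x :=
  PresentedMonoid.surjective_mk x

theorem induction {p : ArtinMonoid M → Prop} (one : p 1) (gen : ∀ a, p (gen M a))
    (mul : ∀ x y, p x → p y → p (x * y)) (x : ArtinMonoid M) : p x := by
  obtain ⟨ω, rfl⟩ := exists_ofWord_eq x
  induction ω with
  | nil => rwa [ofWord_nil]
  | cons a ω ih =>
    rw [ofWord_cons]
    exact mul _ _ (gen a) ih

/-! ### The length function -/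

theorem length_eq_of_artinRel {u v : FreeMonoid B} (h : ArtinRel M u v) :
    FreeMonoid.lift (fun _ => Multiplicative.ofAdd 1) u =
      FreeMonoid.lift (fun _ => Multiplicative.ofAdd (1 : ℕ)) v := by
  obtain ⟨a, b⟩ := h
  simp [FreeMonoid.lift_apply, length_toList_altWord]

variable (M) in
/-- The length function of the Artin monoid, as a homomorphism. -/
def lengthHom : ArtinMonoid M →* Multiplicative ℕ :=
  PresentedMonoid.lift (fun _ => Multiplicative.ofAdd 1) fun _ _ => length_eq_of_artinRel

/-- The length of an element of the Artin monoid. -/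
def len (x : ArtinMonoid M) : ℕ := (lengthHom M x).toAdd

theorem len_one : len (1 : ArtinMonoid M) = 0 := by simp [len]

theorem len_mul (x y : ArtinMonoid M) : len (x * y) = len x + len y := by simp [len]

theorem len_gen (a : B) : len (gen M a) = 1 := rfl

theorem len_ofWord (ω : List B) : len (ofWord M ω) = ω.length := by
  induction ω with
  | nil => rw [ofWord_nil, len_one, List.length_nil]
  | cons a ω ih => rw [ofWord_cons, len_mul, len_gen, ih, List.length_cons, add_comm]

theorem eq_one_of_len_eq_zero {x : ArtinMonoid M} (h : len x = 0) : x = 1 := by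
  obtain ⟨ω, rfl⟩ := exists_ofWord_eq x
  rw [len_ofWord, List.length_eq_zero_iff] at h
  rw [h, ofWord_nil]

theorem genLength_eq_len (x : ArtinMonoid M) : genLength (standardGenerators M) x = len x := by
  have key : {n : ℕ | ∃ w : List (ArtinMonoid M), (∀ y ∈ w, y ∈ standardGenerators M) ∧
      w.length = n ∧ w.prod = x} = {len x} := by
    ext n
    simp only [Set.mem_ofPred_eq, Set.mem_singleton_iff]
    constructor
    · rintro ⟨w, hw, rfl, rfl⟩
      induction w with
      | nil => simp [len_one]
      | cons y w ih =>
        obtain ⟨a, ha⟩ := hw y List.mem_cons_self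
        rw [List.length_cons, List.prod_cons, len_mul,
          ih fun z hz => hw z (List.mem_cons_of_mem y hz), ← ha]
        exact add_comm _ _
    · rintro rfl
      obtain ⟨ω, rfl⟩ := exists_ofWord_eq x
      refine ⟨ω.map (gen M), ?_, by rw [List.length_map, len_ofWord], ?_⟩
      · intro y hy
        obtain ⟨a, -, rfl⟩ := List.mem_map.1 hy
        exact ⟨a, rfl⟩
      · induction ω with
        | nil => rw [ofWord_nil]; rfl
        | cons a ω ih => rw [List.map_cons, List.prod_cons, ih, ofWord_cons]
  rw [genLength, key, csInf_singleton]

/-! ### The reversal antiautomorphism -/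

theorem lift_op_gen (u : FreeMonoid B) :
    FreeMonoid.lift (fun a => MulOpposite.op (gen M a)) u =
      MulOpposite.op (ofWord M u.toList.reverse) := by
  induction u with
  | one => rfl
  | of a => rw [FreeMonoid.lift_eval_of]; rfl
  | mul u v hu hv =>
    rw [map_mul, hu, hv, FreeMonoid.toList_mul, List.reverse_append, ofWord_append]
    rfl

/-- Reversal maps a braid relation to itself, exchanging its sides when the exponent is even. -/
theorem lift_op_gen_eq_of_artinRel {u v : FreeMonoid B} (h : ArtinRel M u v) :
    FreeMonoid.lift (fun a => MulOpposite.op (gen M a)) u =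
      FreeMonoid.lift (fun a => MulOpposite.op (gen M a)) v := by
  obtain ⟨a, b⟩ := h
  rw [lift_op_gen, lift_op_gen, reverse_toList_altWord, reverse_toList_altWord]
  split_ifs
  · rw [ofWord_altWord_swap]
  · rw [ofWord_altWord_swap]

variable (M) in
/-- The antiautomorphism of the Artin monoid that reverses words. -/
def reverseHom : ArtinMonoid M →* (ArtinMonoid M)ᵐᵒᵖ :=
  PresentedMonoid.lift (fun a => MulOpposite.op (gen M a)) fun _ _ => lift_op_gen_eq_of_artinRel

theorem reverseHom_reverseHom (x : ArtinMonoid M) :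
    (reverseHom M (reverseHom M x).unop).unop = x := by
  induction x using induction with
  | one => simp
  | gen a => rfl
  | mul x y hx hy => rw [map_mul, MulOpposite.unop_mul, map_mul, MulOpposite.unop_mul, hx, hy]

theorem reverseHom_injective : Function.Injective (reverseHom M) :=
  Function.LeftInverse.injective (g := fun y => (reverseHom M y.unop).unop) fun x =>
    reverseHom_reverseHom x

end ArtinMonoid

/-! ### Matsumoto's theorem and the normal form action -/

namespace CoxeterSystem

open ArtinMonoid

variable {B W : Type*} [Group W] {M : CoxeterMatrix B} (cs : CoxeterSystem M W)

/-- Matsumoto's theorem: reduced words with the same product represent the same element of the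
Artin monoid. -/
theorem ofWord_eq_of_isReduced {ω ω' : List B} (hω : cs.IsReduced ω) (hω' : cs.IsReduced ω')
    (h : cs.wordProd ω = cs.wordProd ω') : ofWord M ω = ofWord M ω' := by
  induction hn : ω.length generalizing ω ω' with
  | zero =>
    have hl : ω'.length = 0 := by rw [← hω'.eq, ← h, hω.eq, hn]
    rw [List.length_eq_zero_iff] at hn hl
    rw [hn, hl]
  | succ n ih =>
    have head : ∀ {a : B} {χ χ' : List B}, cs.IsReduced (a :: χ) → cs.IsReduced (a :: χ') →
        cs.wordProd (a :: χ) = cs.wordProd (a :: χ') → χ.length = n →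
        ofWord M (a :: χ) = ofWord M (a :: χ') := by
      intro a χ χ' h1 h2 h3 h4
      have h5 : cs.wordProd χ = cs.wordProd χ' := by simpa [wordProd_cons] using h3
      rw [ofWord_cons, ofWord_cons, ih (ω := χ) (ω' := χ') (h1.drop 1) (h2.drop 1) h5 h4]
    obtain ⟨a, χ, rfl⟩ := List.exists_cons_of_length_eq_add_one hn
    have hl : ω'.length = n + 1 := by rw [← hω'.eq, ← h, hω.eq, hn]
    obtain ⟨b, χ', rfl⟩ := List.exists_cons_of_length_eq_add_one hl
    rw [List.length_cons, Nat.add_right_cancel_iff] at hn hl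
    have desc : ∀ {c : B} {ξ : List B}, cs.IsReduced (c :: ξ) →
        cs.IsLeftDescent (cs.wordProd (c :: ξ)) c := by
      intro c ξ h1
      rw [IsLeftDescent, h1.eq, wordProd_cons, simple_mul_simple_cancel_left]
      exact Nat.lt_succ_of_le (cs.length_wordProd_le ξ)
    -- Both first letters are descents, so two further reduced words begin with the two sides of the
    -- braid relation. Each given word shares its first letter with one of them, and induction
    -- applies to the remaining letters.
    obtain ⟨h0, v, hv, hvl⟩ := cs.exists_eq_altWord_mul (desc hω) (h ▸ desc hω')
    obtain ⟨τ, hτ, rfl⟩ := cs.exists_isReduced v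
    have hred : ∀ {ξ : List B}, ξ.length = M a b → cs.wordProd (a :: χ) = cs.wordProd (ξ ++ τ) →
        cs.IsReduced (ξ ++ τ) := by
      intro ξ h1 h2
      rw [IsReduced, ← h2, hvl, hτ.eq, List.length_append, h1]
    have hp₁ : cs.wordProd (a :: χ) = cs.wordProd ((altWord a b (M a b)).toList ++ τ) := by
      rw [hv, wordProd_append]
    have hp₂ : cs.wordProd (a :: χ) = cs.wordProd ((altWord b a (M a b)).toList ++ τ) := by
      rw [hp₁, wordProd_append, wordProd_append, wordProd_altWord_swap]
    have hr₁ := hred (length_toList_altWord a b _) hp₁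
    have hr₂ := hred (length_toList_altWord b a _) hp₂
    have e : ofWord M ((altWord a b (M a b)).toList ++ τ) =
        ofWord M ((altWord b a (M a b)).toList ++ τ) := by
      rw [ofWord_append, ofWord_append, ofWord_altWord_swap]
    rw [h] at hp₂
    obtain ⟨m, hm⟩ := Nat.exists_eq_succ_of_ne_zero h0
    rw [hm, Nat.succ_eq_add_one, toList_altWord_succ, List.cons_append] at hp₁ hp₂ hr₁ hr₂ e
    rw [toList_altWord_succ, List.cons_append] at e
    rw [head hω hr₁ hp₁ hn, e, head hω' hr₂ hp₂ hl]

/-- The canonical lift of an element of the Coxeter group to the Artin monoid. -/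
noncomputable def artinLift (w : W) : ArtinMonoid M :=
  ofWord M (cs.exists_isReduced w).choose

theorem artinLift_wordProd {ω : List B} (hω : cs.IsReduced ω) :
    cs.artinLift (cs.wordProd ω) = ofWord M ω :=
  have h := (cs.exists_isReduced (cs.wordProd ω)).choose_spec
  cs.ofWord_eq_of_isReduced h.1 hω h.2.symm

theorem artinLift_one : cs.artinLift 1 = 1 := by
  rw [← cs.wordProd_nil, artinLift_wordProd cs (by simp [IsReduced]), ofWord_nil]

theorem artinLift_simple (a : B) : cs.artinLift (cs.simple a) = gen M a := by
  rw [← cs.wordProd_singleton, artinLift_wordProd cs (by simp [IsReduced]), ofWord_cons,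
    ofWord_nil, mul_one]

variable {cs} in
theorem IsReducedMul.artinLift_mul {u v : W} (h : cs.IsReducedMul u v) :
    cs.artinLift (u * v) = cs.artinLift u * cs.artinLift v := by
  obtain ⟨ω, hω, rfl⟩ := cs.exists_isReduced u
  obtain ⟨χ, hχ, rfl⟩ := cs.exists_isReduced v
  rw [artinLift_wordProd cs hω, artinLift_wordProd cs hχ, ← ofWord_append, ← wordProd_append]
  apply artinLift_wordProd
  rw [IsReduced, wordProd_append, h, hω.eq, hχ.eq, List.length_append]

/-- Left multiplication by a generator on pairs that consist of a simple element and a remainder: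
the new simple factor is the greatest possible one. -/
noncomputable def normalFormStep (a : B) : Function.End (W × ArtinMonoid M) :=
  fun p =>
    (cs.simple a * (cs.exists_isGreatestPrefix a p.1).choose,
      cs.artinLift ((cs.exists_isGreatestPrefix a p.1).choose⁻¹ * p.1) * p.2)

variable {cs} in
theorem IsPrefix.mul_left {u v w : W} (h : cs.IsPrefix v w) (hu : cs.IsReducedMul u w) :
    cs.IsPrefix (u * v) (u * w) := by
  obtain ⟨x, rfl, hx⟩ := cs.isPrefix_iff.1 h
  exact cs.isPrefix_iff.2 ⟨x, by rw [mul_assoc], (hx.assoc_right hu).2⟩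

variable {cs} in
theorem IsPrefix.of_mul_left {u v w : W} (h : cs.IsPrefix (u * v) (u * w))
    (hu : cs.IsReducedMul u v) : cs.IsPrefix v w := by
  obtain ⟨x, hx, hx'⟩ := cs.isPrefix_iff.1 h
  rw [mul_assoc, mul_left_cancel_iff] at hx
  exact cs.isPrefix_iff.2 ⟨x, hx, (hu.assoc_left hx').1⟩

/-- Taking greatest prefixes letter by letter agrees with taking one for the whole product; this is
what makes the action respect the braid relations. -/
theorem lift_normalFormStep_apply {ω : List B} (hω : cs.IsReduced ω) (p : W × ArtinMonoid M) :
    ∃ v, cs.IsGreatestPrefix (cs.wordProd ω) p.1 v ∧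
      FreeMonoid.lift cs.normalFormStep (FreeMonoid.ofList ω) p =
        (cs.wordProd ω * v, cs.artinLift (v⁻¹ * p.1) * p.2) := by
  induction ω with
  | nil =>
    refine ⟨p.1, ⟨cs.isPrefix_refl _, by simp [IsReducedMul], fun x hx _ => hx⟩, ?_⟩
    rw [wordProd_nil, one_mul, inv_mul_cancel, artinLift_one, one_mul]
    rfl
  | cons a ω ih =>
    have hω' : cs.IsReduced ω := hω.drop 1
    obtain ⟨v, hv, hp⟩ := ih hω'
    have haω : cs.IsReducedMul (cs.simple a) (cs.wordProd ω) := by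
      rw [IsReducedMul, ← wordProd_cons, hω.eq, hω'.eq, length_simple,
        List.length_cons, add_comm]
    have hstep : FreeMonoid.lift cs.normalFormStep (FreeMonoid.ofList (a :: ω)) p =
        cs.normalFormStep a (FreeMonoid.lift cs.normalFormStep (FreeMonoid.ofList ω) p) := by
      rw [FreeMonoid.ofList_cons, map_mul, FreeMonoid.lift_eval_of]
      rfl
    rw [hstep, hp]
    -- The product of ω is itself an admissible prefix, as aω is reduced; hence the chosen prefix
    -- extends it, and z is the remaining factor.
    obtain ⟨z, hz, hzeq⟩ : ∃ z, cs.IsGreatestPrefix (cs.simple a) (cs.wordProd ω * v)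
        (cs.wordProd ω * z) ∧
        (cs.exists_isGreatestPrefix a (cs.wordProd ω * v)).choose = cs.wordProd ω * z :=
      ⟨(cs.wordProd ω)⁻¹ * (cs.exists_isGreatestPrefix a (cs.wordProd ω * v)).choose, by
        rw [mul_inv_cancel_left]
        exact (cs.exists_isGreatestPrefix a (cs.wordProd ω * v)).choose_spec, by
        rw [mul_inv_cancel_left]⟩
    have hωz : cs.IsReducedMul (cs.wordProd ω) z := by
      obtain ⟨y, hy, hy'⟩ := cs.isPrefix_iff.1 (hz.3 _ (cs.isPrefix_iff.2 ⟨v, rfl, hv.2⟩) haω)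
      rwa [mul_left_cancel hy]
    have hzv : cs.IsPrefix z v := hz.1.of_mul_left hωz
    refine ⟨z, ⟨hzv.trans hv.1, ?_, ?_⟩, ?_⟩
    · rw [wordProd_cons]
      exact (hωz.assoc_right hz.2).2
    · intro x hx hx'
      rw [wordProd_cons] at hx'
      obtain ⟨h1, h2⟩ := haω.assoc_left hx'
      exact (hz.3 _ ((hv.3 x hx h1).mul_left hv.2) h2).of_mul_left h1
    · have h1 : cs.IsReducedMul (z⁻¹ * v) (v⁻¹ * p.1) :=
        (IsReducedMul.assoc_left (u := z) hzv (by rw [mul_inv_cancel_left]; exact hv.1)).1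
      have h2 := h1.artinLift_mul
      rw [mul_assoc, mul_inv_cancel_left] at h2
      simp only [normalFormStep, hzeq]
      rw [wordProd_cons, mul_assoc, mul_inv_rev, mul_assoc, inv_mul_cancel_left, h2, mul_assoc]

theorem lift_normalFormStep_eq_of_artinRel {u v : FreeMonoid B} (h : ArtinRel M u v) :
    FreeMonoid.lift cs.normalFormStep u = FreeMonoid.lift cs.normalFormStep v := by
  obtain ⟨a, b⟩ := h
  funext p
  obtain ⟨v, hv, h⟩ := cs.lift_normalFormStep_apply
    (cs.isReduced_altWord a b (m := M a b) fun _ => le_rfl) p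
  obtain ⟨v', hv', h'⟩ := cs.lift_normalFormStep_apply
    (cs.isReduced_altWord b a (m := M a b) fun _ => (M.symmetric a b).le) p
  rw [FreeMonoid.ofList_toList] at h h'
  rw [← wordProd_altWord_swap] at hv' h'
  rw [h, h', hv.eq hv']

/-- The action of the Artin monoid that computes the greatest simple left divisor. -/
noncomputable def normalFormHom : ArtinMonoid M →* Function.End (W × ArtinMonoid M) :=
  PresentedMonoid.lift cs.normalFormStep fun _ _ => cs.lift_normalFormStep_eq_of_artinRel

/-- The greatest simple left divisor of an element of the Artin monoid. -/
noncomputable def simpleHead (x : ArtinMonoid M) : W := (cs.normalFormHom x (1, 1)).1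

/-- The cofactor of the greatest simple left divisor. -/
noncomputable def simpleTail (x : ArtinMonoid M) : ArtinMonoid M :=
  (cs.normalFormHom x (1, 1)).2

theorem normalFormHom_apply_mul (x : ArtinMonoid M) (p : W × ArtinMonoid M) :
    cs.artinLift (cs.normalFormHom x p).1 * (cs.normalFormHom x p).2 =
      x * (cs.artinLift p.1 * p.2) := by
  induction x using ArtinMonoid.induction generalizing p with
  | one =>
    rw [map_one, one_mul]
    rfl
  | gen a =>
    have h := (cs.exists_isGreatestPrefix a p.1).choose_spec
    change cs.artinLift (cs.simple a * _) * (cs.artinLift _ * p.2) = _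
    rw [h.2.artinLift_mul, artinLift_simple, mul_assoc, ← mul_assoc (cs.artinLift _),
      ← IsReducedMul.artinLift_mul h.1, mul_inv_cancel_left]
  | mul x y hx hy =>
    rw [map_mul]
    change cs.artinLift (cs.normalFormHom x (cs.normalFormHom y p)).1 *
      (cs.normalFormHom x (cs.normalFormHom y p)).2 = _
    rw [hx, hy, mul_assoc]

theorem artinLift_simpleHead_mul_simpleTail (x : ArtinMonoid M) :
    cs.artinLift (cs.simpleHead x) * cs.simpleTail x = x := by
  rw [simpleHead, simpleTail, normalFormHom_apply_mul, artinLift_one, mul_one, mul_one]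

/-- This recovers x from head and tail of its multiple by a, the source of cancellation. -/
theorem exists_simpleHead_gen_mul (a : B) (x : ArtinMonoid M) :
    ∃ v, cs.IsReducedMul (cs.simple a) v ∧ cs.simpleHead (gen M a * x) = cs.simple a * v ∧
      x = cs.artinLift v * cs.simpleTail (gen M a * x) := by
  have h := (cs.exists_isGreatestPrefix a (cs.simpleHead x)).choose_spec
  have h1 : cs.normalFormHom (gen M a * x) (1, 1) =
      cs.normalFormStep a (cs.simpleHead x, cs.simpleTail x) := by
    rw [map_mul]
    rfl
  refine ⟨_, h.2, by rw [simpleHead, h1]; rfl, ?_⟩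
  rw [simpleTail, h1]
  change x = _ * (_ * cs.simpleTail x)
  rw [← mul_assoc, ← IsReducedMul.artinLift_mul h.1, mul_inv_cancel_left,
    artinLift_simpleHead_mul_simpleTail]

theorem isLeftDescent_simpleHead_gen_mul (a : B) (x : ArtinMonoid M) :
    cs.IsLeftDescent (cs.simpleHead (gen M a * x)) a := by
  obtain ⟨v, hv, h, -⟩ := cs.exists_simpleHead_gen_mul a x
  rw [IsReducedMul, length_simple] at hv
  rw [h, isLeftDescent_iff, simple_mul_simple_cancel_left, hv, add_comm]

end CoxeterSystem

/-! ### Cancellation, gcds and common multiples -/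

namespace ArtinMonoid

open CoxeterSystem

variable {B : Type*} {M : CoxeterMatrix B}

theorem gen_mul_left_cancel {a : B} {x y : ArtinMonoid M} (h : gen M a * x = gen M a * y) :
    x = y := by
  obtain ⟨v, -, hv, hx⟩ := M.toCoxeterSystem.exists_simpleHead_gen_mul a x
  obtain ⟨v', -, hv', hy⟩ := M.toCoxeterSystem.exists_simpleHead_gen_mul a y
  rw [h, hv', mul_left_cancel_iff] at hv
  rw [hx, hy, h, hv]

protected theorem mul_left_cancel {z x y : ArtinMonoid M} (h : z * x = z * y) : x = y := by
  induction z using induction generalizing x y with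
  | one => simpa using h
  | gen a => exact gen_mul_left_cancel h
  | mul u v hu hv =>
    rw [mul_assoc, mul_assoc] at h
    exact hv (hu h)

protected theorem mul_right_cancel {z x y : ArtinMonoid M} (h : x * z = y * z) : x = y := by
  apply reverseHom_injective
  apply MulOpposite.unop_injective
  apply ArtinMonoid.mul_left_cancel (z := (reverseHom M z).unop)
  rw [← MulOpposite.unop_mul, ← MulOpposite.unop_mul, ← map_mul, ← map_mul, h]

/-- An element that is divisible by two generators on the left is divisible by the corresponding
braid word. -/
theorem exists_eq_altWord_mul {a b : B} {x y : ArtinMonoid M}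
    (h : gen M a * x = gen M b * y) :
    M a b ≠ 0 ∧ ∃ u, gen M a * x = ofWord M (altWord a b (M a b)).toList * u := by
  set cs := M.toCoxeterSystem
  obtain ⟨h0, v, hv, hvl⟩ := cs.exists_eq_altWord_mul (cs.isLeftDescent_simpleHead_gen_mul a x)
    (h ▸ cs.isLeftDescent_simpleHead_gen_mul b y)
  have hred := cs.isReduced_altWord a b (m := M a b) fun _ => le_rfl
  have hmul : cs.IsReducedMul (cs.wordProd (altWord a b (M a b)).toList) v := by
    rw [IsReducedMul, ← hv, hvl, hred.eq, length_toList_altWord]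
  refine ⟨h0, cs.artinLift v * cs.simpleTail (gen M a * x), ?_⟩
  rw [← cs.artinLift_wordProd hred, ← mul_assoc, ← hmul.artinLift_mul, ← hv,
    artinLift_simpleHead_mul_simpleTail]

/-! ### Greatest common left divisors -/

variable (M) in
/-- Right multiplication by a generator. -/
def Step (x y : ArtinMonoid M) : Prop := ∃ b, y = x * gen M b

theorem leftDivides_iff_reflTransGen {x y : ArtinMonoid M} :
    LeftDivides x y ↔ Relation.ReflTransGen (Step M) x y := by
  constructor
  · rintro ⟨z, rfl⟩
    induction z using induction generalizing x with
    | one => rw [mul_one]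
    | gen a => exact .single ⟨a, rfl⟩
    | mul u v hu hv => rw [← mul_assoc]; exact hu.trans hv
  · intro h
    induction h with
    | refl => exact ⟨1, (mul_one x).symm⟩
    | tail _ h ih =>
      obtain ⟨z, rfl⟩ := ih
      obtain ⟨b, rfl⟩ := h
      exact ⟨z * gen M b, mul_assoc _ _ _⟩

theorem leftDivides_trans {x y z : ArtinMonoid M} (h : LeftDivides x y) (h' : LeftDivides y z) :
    LeftDivides x z := by
  obtain ⟨u, rfl⟩ := h
  obtain ⟨v, rfl⟩ := h'
  exact ⟨u * v, mul_assoc _ _ _⟩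

theorem leftDivides_antisymm {x y : ArtinMonoid M} (h : LeftDivides x y) (h' : LeftDivides y x) :
    x = y := by
  obtain ⟨u, rfl⟩ := h
  obtain ⟨v, hv⟩ := h'
  have h1 := congrArg len hv
  rw [len_mul, len_mul] at h1
  rw [eq_one_of_len_eq_zero (x := u) (by omega), mul_one]

theorem len_le_of_leftDivides {x y : ArtinMonoid M} (h : LeftDivides x y) : len x ≤ len y := by
  obtain ⟨u, rfl⟩ := h
  rw [len_mul]
  exact Nat.le_add_right _ _

theorem leftDivides_mul_altWord {x : ArtinMonoid M} {b c : B} (h0 : M b c ≠ 0) :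
    LeftDivides (x * gen M b) (x * ofWord M (altWord b c (M b c)).toList) := by
  obtain ⟨m, hm⟩ := Nat.exists_eq_succ_of_ne_zero h0
  rw [hm, toList_altWord_succ, ofWord_cons]
  exact ⟨_, (mul_assoc _ _ _).symm⟩

theorem mul_altWord_leftDivides {x u : ArtinMonoid M} {b c : B}
    (hb : LeftDivides (x * gen M b) u) (hc : LeftDivides (x * gen M c) u) :
    M b c ≠ 0 ∧ LeftDivides (x * ofWord M (altWord b c (M b c)).toList) u := by
  obtain ⟨p, rfl⟩ := hb
  obtain ⟨q, hq⟩ := hc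
  rw [mul_assoc, mul_assoc] at hq
  obtain ⟨h0, z, hz⟩ := exists_eq_altWord_mul (ArtinMonoid.mul_left_cancel hq)
  exact ⟨h0, z, by rw [mul_assoc, mul_assoc, hz]⟩

/-- The common divisors of u and v have length at most that of u, and with xb and xc they contain x
times the braid word, so the diamond argument applies. -/
theorem hasLeftGCD : HasLeftGCD (ArtinMonoid M) := by
  intro u v
  obtain ⟨d, ⟨hdu, hdv⟩, hd⟩ := Relation.ReflTransGen.exists_greatest (r := Step M)
    (X := {x | LeftDivides x u ∧ LeftDivides x v}) (f := len) (N := len u) (x := 1)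
    (by
      rintro x _ ⟨b, rfl⟩
      rw [len_mul, len_gen]
      exact Nat.lt_succ_self _)
    (fun x hx => len_le_of_leftDivides hx.1)
    (fun x y h hy =>
      have hxy := leftDivides_iff_reflTransGen.2 (.single h)
      ⟨leftDivides_trans hxy hy.1, leftDivides_trans hxy hy.2⟩)
    (by
      rintro x _ _ - ⟨hbu, hbv⟩ ⟨hcu, hcv⟩ ⟨b, rfl⟩ ⟨c, rfl⟩
      obtain ⟨h0, hu⟩ := mul_altWord_leftDivides hbu hcu
      refine ⟨_, ⟨hu, (mul_altWord_leftDivides hbv hcv).2⟩,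
        leftDivides_iff_reflTransGen.1 (leftDivides_mul_altWord h0),
        leftDivides_iff_reflTransGen.1 ?_⟩
      rw [ofWord_altWord_swap, M.symmetric]
      exact leftDivides_mul_altWord (by rwa [M.symmetric]))
    ⟨⟨u, (one_mul u).symm⟩, ⟨v, (one_mul v).symm⟩⟩
  have hd' : ∀ w, LeftDivides w u → LeftDivides w v → LeftDivides w d := fun w hu hv =>
    leftDivides_iff_reflTransGen.2
      (hd w ⟨hu, hv⟩ (leftDivides_iff_reflTransGen.1 ⟨w, (one_mul w).symm⟩))
  exact ⟨d, ⟨hdu, hdv, hd'⟩, fun d' h => leftDivides_antisymm (hd' d' h.1 h.2.1) (h.2.2 d hdu hdv)⟩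

/-! ### Common multiples in finite type -/

theorem exists_artinLift_mul_eq {W : Type*} [Group W] [Finite W] (cs : CoxeterSystem M W)
    (x y : W) : ∃ x' y', cs.artinLift x' * cs.artinLift x = cs.artinLift y' * cs.artinLift y := by
  obtain ⟨w₀, h⟩ := cs.exists_forall_isPrefix
  -- Since x⁻¹ is a prefix of w₀, inverting shows that w₀⁻¹ = (x w₀)⁻¹ x is a reduced product.
  have key (x : W) : cs.artinLift ((x * w₀)⁻¹) * cs.artinLift x = cs.artinLift w₀⁻¹ := by
    have h1 := h x⁻¹
    rw [IsPrefix, IsReducedMul, mul_inv_cancel_left, inv_inv, length_inv] at h1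
    have h2 : cs.IsReducedMul (x * w₀)⁻¹ x := by
      rw [IsReducedMul, mul_inv_rev, inv_mul_cancel_right, length_inv, h1, ← mul_inv_rev,
        length_inv, add_comm]
    rw [← h2.artinLift_mul, mul_inv_rev, inv_mul_cancel_right]
  exact ⟨_, _, (key x).trans (key y).symm⟩

/-- The left cofactor of u stays a lift from W, so the squares for single generators can be pasted
along u. -/
theorem exists_artinLift_mul_eq_mul {W : Type*} [Group W] [Finite W] (cs : CoxeterSystem M W)
    (u : ArtinMonoid M) (y : W) : ∃ y' a, cs.artinLift y' * u = a * cs.artinLift y := by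
  induction u using induction generalizing y with
  | one => exact ⟨y, 1, by rw [mul_one, one_mul]⟩
  | gen b =>
    obtain ⟨x', y', h⟩ := exists_artinLift_mul_eq cs (cs.simple b) y
    exact ⟨x', _, by rw [← h, artinLift_simple]⟩
  | mul u v hu hv =>
    obtain ⟨p, a, h⟩ := hv y
    obtain ⟨p', a', h'⟩ := hu p
    exact ⟨p', a' * a, by rw [← mul_assoc, h', mul_assoc, h, mul_assoc]⟩

theorem exists_mul_eq_mul (hM : M.IsFiniteType) (u v : ArtinMonoid M) :
    ∃ a b, a * u = b * v := by
  have : Finite M.Group := hM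
  induction v using induction generalizing u with
  | one => exact ⟨1, u, by rw [mul_one, one_mul]⟩
  | gen c =>
    obtain ⟨y', a, h⟩ := exists_artinLift_mul_eq_mul M.toCoxeterSystem u
      (M.toCoxeterSystem.simple c)
    exact ⟨_, a, by rw [h, artinLift_simple]⟩
  | mul v w hv hw =>
    obtain ⟨a, b, h⟩ := hw u
    obtain ⟨c, d, h'⟩ := hv b
    exact ⟨c * a, d, by rw [mul_assoc, h, ← mul_assoc, h', mul_assoc]⟩

variable (M) in
theorem infinite_of_nonempty [Nonempty B] : Infinite (ArtinMonoid M) := by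
  obtain ⟨b⟩ := ‹Nonempty B›
  have h : ∀ n : ℕ, len (gen M b ^ n) = n := by
    intro n
    induction n with
    | zero => rw [pow_zero, len_one]
    | succ n ih => rw [pow_succ, len_mul, ih, len_gen]
  exact Infinite.of_injective (fun n : ℕ => gen M b ^ n) (Function.LeftInverse.injective h)

end ArtinMonoid

theorem mainTheorem8 {B : Type*} [Finite B] [Nonempty B] (M : CoxeterMatrix B)
    (hM : M.IsFiniteType) :
    IsOfClassC (ArtinMonoid M) (ArtinMonoid.standardGenerators M) where
  finite_generators := Set.finite_range _
  generates := PresentedMonoid.closure_range_of _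
  infinite := ArtinMonoid.infinite_of_nonempty M
  cancellative _ _ _ _ h := ArtinMonoid.mul_left_cancel (ArtinMonoid.mul_right_cancel h)
  homogeneous g h := by
    simp only [ArtinMonoid.genLength_eq_len, ArtinMonoid.len_mul]
  leftGCD := ArtinMonoid.hasLeftGCD
  commonRightMultiples u v := by
    obtain ⟨a, b, h⟩ := ArtinMonoid.exists_mul_eq_mul hM u v
    exact ⟨a * u, ⟨a, rfl⟩, ⟨b, h⟩⟩
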